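/- Let $H$ be a complex Hilbert space, $\mathcal{B}(H)$ its algebra of bounded operators with operator norm $\|\cdot\|$, and $\mathcal{K}(H)$ the ideal of compact operators. A symmetrically normed ideal (sn-ideal) is a two-sided ideal $\mathcal{I}\trianglelefteq\mathcal{B}(H)$ that is complete under a norm $\|\cdot\|_{\mathcal{I}}$ satisfying $\|AXB\|_{\mathcal{I}}\le\|A\|\,\|X\|_{\mathcal{I}}\,\|B\|$ for all $X\in\mathcal{I}$ and $A,B\in\mathcal{B}(H)$, and $\|X\|_{\mathcal{I}}=\|X\|$ for all rank-one $X\in\mathcal{I}$. It is approximable if the finite-rank operators in $\mathcal{I}$ are $\|\cdot\|_{\mathcal{I}}$-dense in $\mathcal{I}$. The multiplier topology $\mu_{\mathcal{I}}$ is the locally convex topology on $\mathcal{B}(H)$ induced by the seminorms $x\mapsto\|xy\|_{\mathcal{I}}$, $y\in\mathcal{I}$; the topology $\mu^*_{\mathcal{I}}$ is the locally convex topology induced by the seminorms $x\mapsto\|xy\|_{\mathcal{I}}$ and $x\mapsto\|yx\|_{\mathcal{I}}$, $y\in\mathcal{I}$. Let $\mu_{\mathcal{K}}$, $\mu^*_{\mathcal{K}}$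 be these topologies for $\mathcal{K}=\mathcal{K}(H)$ with the operator norm. The strict topology on $\mathcal{B}(H)$ (regarded as the multiplier algebra of $\mathcal{K}(H)$) is the locally convex topology induced by the seminorms $x\mapsto\|xk\|$ and $x\mapsto\|kx\|$, $k\in\mathcal{K}(H)$. Write $\sigma\preceq\tau$ if every $\sigma$-open set is $\tau$-open. Then for every approximable sn-ideal $\mathcal{I}\subseteq\mathcal{K}(H)$, $$\mu_{\mathcal{I}}\preceq\mu_{\mathcal{K}}\quad\text{and}\quad\mu^*_{\mathcal{I}}\preceq\mu^*_{\mathcal{K}}.$$ In particular, both $\mu_{\mathcal{I}}$ and $\mu^*_{\mathcal{I}}$ are coarser than (or equal to) the strict topology on $\mathcal{B}(H)$. -/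

import Mathlib

open Topology Filter

noncomputable section

/-- A symmetrically normed ideal (sn-ideal) of the algebra `B(H)` of bounded operators:
a two-sided ideal, complete with respect to a symmetric norm. -/
structure SNIdeal (H : Type*) [NormedAddCommGroup H] [InnerProductSpace ℂ H]
    [CompleteSpace H] where
  /-- The underlying linear subspace of `B(H)`. -/
  carrier : Submodule ℂ (H →L[ℂ] H)
  mul_mem_left : ∀ (A : H →L[ℂ] H) {X : H →L[ℂ] H}, X ∈ carrier → A * X ∈ carrier
  mul_mem_right : ∀ {X : H →L[ℂ] H} (B : H →L[ℂ] H), X ∈ carrier → X * B ∈ carrier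
  /-- The symmetric norm; it is a norm by `eq_zero_of_norm_eq_zero`. -/
  norm : Seminorm ℂ carrier
  eq_zero_of_norm_eq_zero : ∀ X : carrier, norm X = 0 → X = 0
  norm_mul_mul_le : ∀ (A B : H →L[ℂ] H) (X : carrier),
    norm ⟨A * (X : H →L[ℂ] H) * B, mul_mem_right B (mul_mem_left A X.2)⟩ ≤ ‖A‖ * norm X * ‖B‖
  norm_rank_one : ∀ X : carrier,
    Module.finrank ℂ (LinearMap.range ((X : H →L[ℂ] H) : H →ₗ[ℂ] H)) = 1 →
      norm X = ‖(X : H →L[ℂ] H)‖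
  complete : ∀ u : ℕ → carrier,
    (∀ ε : ℝ, 0 < ε → ∃ N : ℕ, ∀ m ≥ N, ∀ n ≥ N, norm (u m - u n) < ε) →
      ∃ X : carrier, Tendsto (fun n => norm (u n - X)) atTop (𝓝 0)

namespace SNIdeal

variable {H : Type*} [NormedAddCommGroup H] [InnerProductSpace ℂ H] [CompleteSpace H]

/-- The closure `I₀`, under the symmetric norm of `I`, of the finite-rank operators in `I`. -/
def approximablePart (I : SNIdeal H) : Set I.carrier :=
  {X | ∀ ε : ℝ, 0 < ε → ∃ F : I.carrier,
    FiniteDimensional ℂ (LinearMap.range ((F : H →L[ℂ] H) : H →ₗ[ℂ] H)) ∧ I.norm (X - F) < ε}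

/-- An sn-ideal `I` is approximable if `I₀ = I`. -/
def IsApproximable (I : SNIdeal H) : Prop := I.approximablePart = Set.univ

/-- The seminorm `x ↦ ‖x y‖_I` on `B(H)`, for `y ∈ I`. -/
def leftSeminorm (I : SNIdeal H) (y : I.carrier) : Seminorm ℂ (H →L[ℂ] H) :=
  I.norm.comp ((LinearMap.mulRight ℂ (y : H →L[ℂ] H)).codRestrict I.carrier
    (fun x => I.mul_mem_left x y.2))

/-- The seminorm `x ↦ ‖y x‖_I` on `B(H)`, for `y ∈ I`. -/
def rightSeminorm (I : SNIdeal H) (y : I.carrier) : Seminorm ℂ (H →L[ℂ] H) :=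
  I.norm.comp ((LinearMap.mulLeft ℂ (y : H →L[ℂ] H)).codRestrict I.carrier
    (fun x => I.mul_mem_right x y.2))

/-- The (left) multiplier topology `μ_I` on `B(H)`: the locally convex topology induced by the
seminorms `x ↦ ‖x y‖_I`, `y ∈ I`. -/
def multiplierTopology (I : SNIdeal H) : TopologicalSpace (H →L[ℂ] H) :=
  (SeminormFamily.moduleFilterBasis (𝕜 := ℂ) I.leftSeminorm).topology

/-- The multiplier* topology `μ*_I` on `B(H)`: the locally convex topology induced by all the
seminorms `x ↦ ‖x y‖_I` and `x ↦ ‖y x‖_I`, `y ∈ I`. -/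
def multiplierStarTopology (I : SNIdeal H) : TopologicalSpace (H →L[ℂ] H) :=
  (SeminormFamily.moduleFilterBasis (𝕜 := ℂ)
    (Sum.elim I.leftSeminorm I.rightSeminorm)).topology

/-- The sn-ideal `K(H)` of compact operators, with the operator norm. -/
def compacts (H : Type*) [NormedAddCommGroup H] [InnerProductSpace ℂ H] [CompleteSpace H] :
    SNIdeal H where
  carrier := compactOperator (RingHom.id ℂ) H H
  mul_mem_left A _ hX := IsCompactOperator.clm_comp hX A
  mul_mem_right B hX := IsCompactOperator.comp_clm hX B
  norm := (normSeminorm ℂ (H →L[ℂ] H)).comp (compactOperator (RingHom.id ℂ) H H).subtype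
  eq_zero_of_norm_eq_zero X h := Subtype.ext (norm_eq_zero.mp h)
  norm_mul_mul_le A B X := by
    change ‖A * (X : H →L[ℂ] H) * B‖ ≤ ‖A‖ * ‖(X : H →L[ℂ] H)‖ * ‖B‖
    exact (norm_mul_le _ _).trans (mul_le_mul_of_nonneg_right (norm_mul_le _ _) (norm_nonneg _))
  norm_rank_one _ _ := rfl
  complete u hu := by
    have hc : CauchySeq (fun n => (u n : H →L[ℂ] H)) := by
      refine Metric.cauchySeq_iff.2 fun ε hε => ?_
      obtain ⟨N, hN⟩ := hu ε hε
      exact ⟨N, fun m hm n hn => by rw [dist_eq_norm]; exact hN m hm n hn⟩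
    obtain ⟨X, hX⟩ := cauchySeq_tendsto_of_complete hc
    exact ⟨⟨X, isCompactOperator_of_tendsto hX (Eventually.of_forall fun n => (u n).2)⟩,
      tendsto_iff_norm_sub_tendsto_zero.1 hX⟩

end SNIdeal

/-- The strict topology on `B(H)`, viewed as the multiplier algebra of `K(H)`: the locally convex
topology induced by the seminorms `x ↦ ‖x k‖` and `x ↦ ‖k x‖`, `k` compact. -/
def strictTopology (H : Type*) [NormedAddCommGroup H] [InnerProductSpace ℂ H] :
    TopologicalSpace (H →L[ℂ] H) :=
  (SeminormFamily.moduleFilterBasis (𝕜 := ℂ) (Sum.elim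
    (fun k : {k : H →L[ℂ] H // IsCompactOperator k} =>
      (normSeminorm ℂ (H →L[ℂ] H)).comp (LinearMap.mulRight ℂ (k : H →L[ℂ] H)))
    (fun k : {k : H →L[ℂ] H // IsCompactOperator k} =>
      (normSeminorm ℂ (H →L[ℂ] H)).comp (LinearMap.mulLeft ℂ (k : H →L[ℂ] H))))).topology

/-- `s` is coarser than (or equal to) `t`: every `s`-open set is `t`-open. -/
def IsCoarser {X : Type*} (s t : TopologicalSpace X) : Prop :=
  ∀ U : Set X, IsOpen[s] U → IsOpen[t] U

end

/-! Each seminorm attached to `y ∈ I` is dominated by the one attached to a single compact `k`.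
Approximate `y` by finite-rank `F n` at geometric speed and let `p n` be increasing finite-rank
projections that absorb the earlier `F j` on both sides, so that `(1 - p n) y` and `y (1 - p n)`
have `I`-norm `O(4⁻ⁿ)`. With `q n = p (n + 1) - p n`, the operator `k = ∑ 2⁻ⁿ q n` is compact, and
`x y = ∑ x q n y = ∑ 2ⁿ (x k) (q n y)`, whose terms are at most `D 2⁻ⁿ ‖x k‖`; the other side is
symmetric. The analytic core is `exists_compact_seminorm_le`;
`IsApproximable.exists_compact_seminorm_le` supplies the projections. -/

theorem isCoarser_of_forall_exists_le {E ι ι' : Type*} [AddCommGroup E] [Module ℂ E]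
    (p : SeminormFamily ℂ E ι) (q : SeminormFamily ℂ E ι')
    (h : ∀ i, ∃ j, ∃ C : ℝ, ∀ x, p i x ≤ C * q j x) :
    IsCoarser p.moduleFilterBasis.topology q.moduleFilterBasis.topology := by
  have hc : @Continuous E E q.moduleFilterBasis.topology p.moduleFilterBasis.topology
      (LinearMap.id : E →ₗ[ℂ] E) :=
    WithSeminorms.continuous_of_isBounded
      (@WithSeminorms.mk _ _ _ _ _ _ q q.moduleFilterBasis.topology rfl)
      (@WithSeminorms.mk _ _ _ _ _ _ p p.moduleFilterBasis.topology rfl) LinearMap.id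
      (Seminorm.IsBounded.of_real fun i => by
        obtain ⟨j, C, hC⟩ := h i
        exact ⟨{j}, C, fun x => by simpa using hC x⟩)
  exact fun U hU => @IsOpen.preimage _ _ q.moduleFilterBasis.topology
    p.moduleFilterBasis.topology _ hc U hU

/-! ### Chains of compact projections -/

section Chain

variable {H : Type*} [NormedAddCommGroup H] [InnerProductSpace ℂ H] [CompleteSpace H]

/-- For an increasing sequence `p` of compact projections starting at `0`, the operator
`∑ 2⁻ⁿ (p (n + 1) - p n)` is compact and acts as `2⁻ⁿ` on the successive differences. -/
theorem exists_compact_mul_sub_eq_smul (p : ℕ → H →L[ℂ] H)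
    (hp1 : ∀ n, ‖p n‖ ≤ 1) (hpc : ∀ n, IsCompactOperator (p n))
    (hl : ∀ m n, m ≤ n → p m * p n = p m) (hr : ∀ m n, m ≤ n → p n * p m = p m) :
    ∃ k : H →L[ℂ] H, IsCompactOperator k ∧
      ∀ n, k * (p (n + 1) - p n) = (1 / 2 : ℂ) ^ n • (p (n + 1) - p n) ∧
        (p (n + 1) - p n) * k = (1 / 2 : ℂ) ^ n • (p (n + 1) - p n) := by
  set q : ℕ → H →L[ℂ] H := fun n => p (n + 1) - p n with hq
  have hqq : ∀ n, q n * q n = q n := fun n => by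
    simp only [hq, mul_sub, sub_mul, hl _ _ le_rfl, hl n (n + 1) n.le_succ,
      hr n (n + 1) n.le_succ]
    abel
  have hlt : ∀ m n, m < n → q m * q n = 0 := fun m n h => by
    simp only [hq, mul_sub, sub_mul, hl m n h.le, hl (m + 1) n h,
      hl m (n + 1) (by omega), hl (m + 1) (n + 1) (by omega)]
    abel
  have hgt : ∀ m n, n < m → q m * q n = 0 := fun m n h => by
    simp only [hq, mul_sub, sub_mul, hr n m h.le, hr (n + 1) m h,
      hr n (m + 1) (by omega), hr (n + 1) (m + 1) (by omega)]
    abel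
  have hne : ∀ m n, m ≠ n → q m * q n = 0 := fun m n h =>
    h.lt_or_gt.elim (hlt m n) (hgt m n)
  -- The weights give absolute convergence in operator norm, so the sum is a norm limit of compact
  -- operators.
  have hs : Summable fun n => (1 / 2 : ℂ) ^ n • q n := by
    refine Summable.of_norm_bounded (g := fun n => (1 / 2 : ℝ) ^ n * 2)
      (summable_geometric_two.mul_right 2) fun n => ?_
    rw [norm_smul, norm_pow]
    have h2 : ‖q n‖ ≤ 2 := (norm_sub_le _ _).trans (by linarith [hp1 n, hp1 (n + 1)])
    have : ‖(1 / 2 : ℂ)‖ = 1 / 2 := by norm_num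
    rw [this]
    gcongr
  refine ⟨∑' n, (1 / 2 : ℂ) ^ n • q n, ?_, fun n => ⟨?_, ?_⟩⟩
  · refine isCompactOperator_of_tendsto hs.hasSum.tendsto_sum_nat
      (Eventually.of_forall fun N => ?_)
    exact Submodule.sum_mem (compactOperator (RingHom.id ℂ) H H) fun n _ =>
      Submodule.smul_mem _ _ (Submodule.sub_mem _ (hpc (n + 1)) (hpc n))
  · rw [← hs.tsum_mul_right, tsum_eq_single n fun m hm => by
      rw [smul_mul_assoc, hne m n hm, smul_zero], smul_mul_assoc, hqq]
  · rw [← hs.tsum_mul_left, tsum_eq_single n fun m hm => by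
      rw [mul_smul_comm, hne n m hm.symm, smul_zero], mul_smul_comm, hqq]

/-- A sum of differences controlled by a geometric series, for a seminorm on `B(H)`. -/
theorem Seminorm.le_of_forall_apply_sub_le {E : Type*} [AddCommGroup E] [Module ℂ E]
    (S : Seminorm ℂ E) (x : E) (u : ℕ → E) (h0 : u 0 = 0) (C D : ℝ)
    (hu : ∀ n, S (u (n + 1) - u n) ≤ C * (1 / 2) ^ n)
    (hx : ∀ n, S (x - u n) ≤ D * (1 / 4) ^ n) : S x ≤ 2 * C := by
  have hC : 0 ≤ C := by simpa using (apply_nonneg S _).trans (hu 0)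
  -- The exact partial sum of the geometric series lets the induction close.
  have hpart : ∀ N, S (u N) ≤ C * (2 - 2 * (1 / 2) ^ N) := fun N => by
    induction N with
    | zero => simp [h0]
    | succ N ih =>
      calc S (u (N + 1)) = S (u N + (u (N + 1) - u N)) := by congr 1; abel
        _ ≤ _ := map_add_le_add S _ _
        _ ≤ C * (2 - 2 * (1 / 2) ^ N) + C * (1 / 2) ^ N := add_le_add ih (hu N)
        _ = _ := by ring
  have hlim : Tendsto (fun N : ℕ => 2 * C + D * (1 / 4 : ℝ) ^ N) atTop (𝓝 (2 * C + D * 0)) :=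
    ((tendsto_pow_atTop_nhds_zero_of_lt_one (by norm_num) (by norm_num)).const_mul D).const_add _
  rw [mul_zero, add_zero] at hlim
  refine ge_of_tendsto' hlim fun N => ?_
  calc S x = S (u N + (x - u N)) := by congr 1; abel
    _ ≤ _ := map_add_le_add S _ _
    _ ≤ C * (2 - 2 * (1 / 2) ^ N) + D * (1 / 4) ^ N := add_le_add (hpart N) (hx N)
    _ ≤ _ := by
      have : 0 ≤ C * (1 / 2) ^ N := by positivity
      linarith

/-- If two seminorms on `B(H)` satisfy `L (a b) ≤ ‖a‖ L b` and `R (a b) ≤ R a ‖b‖`, and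
`1 - p n` is geometrically small for both, they are dominated by `x ↦ ‖x k‖` and `x ↦ ‖k x‖`
for a single compact operator `k`. -/
theorem exists_compact_seminorm_le (L R : Seminorm ℂ (H →L[ℂ] H))
    (hL : ∀ a b, L (a * b) ≤ ‖a‖ * L b) (hR : ∀ a b, R (a * b) ≤ R a * ‖b‖)
    (p : ℕ → H →L[ℂ] H) (hp0 : p 0 = 0)
    (hp1 : ∀ n, ‖p n‖ ≤ 1) (hpc : ∀ n, IsCompactOperator (p n))
    (hl : ∀ m n, m ≤ n → p m * p n = p m) (hr : ∀ m n, m ≤ n → p n * p m = p m) (D : ℝ)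
    (hLp : ∀ n, L (1 - p n) ≤ D * (1 / 4) ^ n) (hRp : ∀ n, R (1 - p n) ≤ D * (1 / 4) ^ n) :
    ∃ k : H →L[ℂ] H, IsCompactOperator k ∧
      ∀ x, L x ≤ 2 * D * ‖x * k‖ ∧ R x ≤ 2 * D * ‖k * x‖ := by
  obtain ⟨k, hk, hkq⟩ := exists_compact_mul_sub_eq_smul p hp1 hpc hl hr
  have hD : 0 ≤ D := by simpa using (apply_nonneg L _).trans (hLp 0)
  have hscale : ∀ n : ℕ, (2 : ℂ) ^ n * (1 / 2) ^ n = 1 := fun n => by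
    rw [← mul_pow]; norm_num
  have hgeom : ∀ n : ℕ, (2 : ℝ) ^ n * (1 / 4) ^ n = (1 / 2) ^ n := fun n => by
    rw [← mul_pow]; norm_num
  refine ⟨k, hk, fun x => ⟨?_, ?_⟩⟩
  -- `L` only tolerates factors on the left, so `p (n + 1)` is pulled out there; for `R` it is
  -- pulled out on the right.
  · have hLq : ∀ n, L (p (n + 1) - p n) ≤ D * (1 / 4) ^ n := fun n => by
      have : p (n + 1) - p n = p (n + 1) * (1 - p n) := by
        rw [mul_sub, mul_one, hr n (n + 1) n.le_succ]
      rw [this]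
      exact (hL _ _).trans ((mul_le_of_le_one_left (apply_nonneg L _) (hp1 _)).trans (hLp n))
    have := L.le_of_forall_apply_sub_le x (fun n => x * p n) (by simp [hp0]) (‖x * k‖ * D)
      (‖x‖ * D) (fun n => ?_) fun n => ?_
    · linarith
    -- Undoing the weight of `k` costs `2ⁿ`, which the decay `4⁻ⁿ` absorbs, leaving `2⁻ⁿ`.
    · have e : x * p (n + 1) - x * p n = (2 : ℂ) ^ n • ((x * k) * (p (n + 1) - p n)) := by
        rw [mul_assoc, (hkq n).1, mul_smul_comm, smul_smul, hscale, one_smul, mul_sub]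
      rw [e, map_smul_eq_mul, norm_pow, Complex.norm_ofNat]
      calc (2 : ℝ) ^ n * L (x * k * (p (n + 1) - p n))
          ≤ 2 ^ n * (‖x * k‖ * (D * (1 / 4) ^ n)) := by
            gcongr
            exact (hL _ _).trans (mul_le_mul_of_nonneg_left (hLq n) (norm_nonneg _))
        _ = ‖x * k‖ * D * (2 ^ n * (1 / 4) ^ n) := by ring
        _ = _ := by rw [hgeom]
    · have e : x - x * p n = x * (1 - p n) := by rw [mul_sub, mul_one]
      rw [e, mul_assoc]
      exact (hL _ _).trans (mul_le_mul_of_nonneg_left (hLp n) (norm_nonneg _))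
  · have hRq : ∀ n, R (p (n + 1) - p n) ≤ D * (1 / 4) ^ n := fun n => by
      have : p (n + 1) - p n = (1 - p n) * p (n + 1) := by
        rw [sub_mul, one_mul, hl n (n + 1) n.le_succ]
      rw [this]
      exact (hR _ _).trans ((mul_le_of_le_one_right (apply_nonneg R _) (hp1 _)).trans (hRp n))
    have := R.le_of_forall_apply_sub_le x (fun n => p n * x) (by simp [hp0]) (‖k * x‖ * D)
      (‖x‖ * D) (fun n => ?_) fun n => ?_
    · linarith
    · have e : p (n + 1) * x - p n * x = (2 : ℂ) ^ n • ((p (n + 1) - p n) * (k * x)) := by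
        rw [← mul_assoc, (hkq n).2, smul_mul_assoc, smul_smul, hscale, one_smul, sub_mul]
      rw [e, map_smul_eq_mul, norm_pow, Complex.norm_ofNat]
      calc (2 : ℝ) ^ n * R ((p (n + 1) - p n) * (k * x))
          ≤ 2 ^ n * (D * (1 / 4) ^ n * ‖k * x‖) := by
            gcongr
            exact (hR _ _).trans (mul_le_mul_of_nonneg_right (hRq n) (norm_nonneg _))
        _ = ‖k * x‖ * D * (2 ^ n * (1 / 4) ^ n) := by ring
        _ = _ := by rw [hgeom]
    · have e : x - p n * x = (1 - p n) * x := by rw [sub_mul, one_mul]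
      rw [e]
      refine (hR _ _).trans ((mul_le_mul_of_nonneg_right (hRp n) (norm_nonneg _)).trans_eq ?_)
      ring

/-- `F` is injective on `(ker F)ᗮ`, which therefore embeds in the range. -/
theorem finiteDimensional_orthogonal_ker {H : Type*} [NormedAddCommGroup H]
    [InnerProductSpace ℂ H] (F : H →L[ℂ] H)
    (hF : FiniteDimensional ℂ (LinearMap.range (F : H →ₗ[ℂ] H))) :
    FiniteDimensional ℂ (LinearMap.ker (F : H →ₗ[ℂ] H))ᗮ := by
  refine FiniteDimensional.of_injective
    ((F : H →ₗ[ℂ] H).rangeRestrict.domRestrict (LinearMap.ker (F : H →ₗ[ℂ] H))ᗮ) ?_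
  refine (injective_iff_map_eq_zero _).2 fun v hv => ?_
  have hv' : (v : H) ∈ LinearMap.ker (F : H →ₗ[ℂ] H) := congrArg Subtype.val hv
  exact Subtype.ext (inner_self_eq_zero (𝕜 := ℂ).1 (v.2 _ hv'))

theorem starProjection_mul_of_range_le {H : Type*} [NormedAddCommGroup H]
    [InnerProductSpace ℂ H] (F : H →L[ℂ] H) (W : Submodule ℂ H)
    [W.HasOrthogonalProjection] (h : LinearMap.range (F : H →ₗ[ℂ] H) ≤ W) :
    W.starProjection * F = F :=
  ContinuousLinearMap.ext fun v =>
    Submodule.starProjection_eq_self_iff.2 (h (LinearMap.mem_range_self _ v))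

/-- The kernel is closed, hence equal to its double orthogonal complement, which contains `Wᗮ`. -/
theorem mul_starProjection_of_orthogonal_ker_le (F : H →L[ℂ] H) (W : Submodule ℂ H)
    [W.HasOrthogonalProjection] (h : (LinearMap.ker (F : H →ₗ[ℂ] H))ᗮ ≤ W) :
    F * W.starProjection = F := by
  have : CompleteSpace (LinearMap.ker (F : H →ₗ[ℂ] H)) := F.isClosed_ker.completeSpace_coe
  refine ContinuousLinearMap.ext fun v => ?_
  have hv : v - W.starProjection v ∈ LinearMap.ker (F : H →ₗ[ℂ] H) := by
    rw [← Submodule.orthogonal_orthogonal (LinearMap.ker (F : H →ₗ[ℂ] H))]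
    exact Submodule.orthogonal_le h (Submodule.sub_starProjection_mem_orthogonal v)
  have hv' : F (v - W.starProjection v) = 0 := hv
  rw [map_sub, sub_eq_zero] at hv'
  exact hv'.symm

theorem isCompactOperator_starProjection {H : Type*} [NormedAddCommGroup H]
    [InnerProductSpace ℂ H] (W : Submodule ℂ H) [FiniteDimensional ℂ W] :
    IsCompactOperator W.starProjection :=
  have := FiniteDimensional.proper ℂ W
  (isCompactOperator_of_locallyCompactSpace_rng W.subtypeL).comp_clm W.orthogonalProjectionOnto

end Chain

/-! ### Seminorms of an sn-ideal -/

namespace SNIdeal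

variable {H : Type*} [NormedAddCommGroup H] [InnerProductSpace ℂ H] [CompleteSpace H]

theorem leftSeminorm_mul_le (I : SNIdeal H) (y : I.carrier) (a b : H →L[ℂ] H) :
    I.leftSeminorm y (a * b) ≤ ‖a‖ * I.leftSeminorm y b := by
  have h := I.norm_mul_mul_le a 1 ⟨b * (y : H →L[ℂ] H), I.mul_mem_left b y.2⟩
  refine le_trans (le_of_eq ?_) (h.trans
    (mul_le_of_le_one_right (by positivity) ContinuousLinearMap.norm_id_le))
  exact congrArg I.norm (Subtype.ext ((mul_assoc a b _).trans (mul_one _).symm))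

theorem rightSeminorm_mul_le (I : SNIdeal H) (y : I.carrier) (a b : H →L[ℂ] H) :
    I.rightSeminorm y (a * b) ≤ I.rightSeminorm y a * ‖b‖ := by
  have h := I.norm_mul_mul_le 1 b ⟨(y : H →L[ℂ] H) * a, I.mul_mem_right a y.2⟩
  refine le_trans (le_of_eq ?_) (h.trans (mul_le_mul_of_nonneg_right
    (mul_le_of_le_one_left (apply_nonneg _ _) ContinuousLinearMap.norm_id_le) (norm_nonneg _)))
  exact congrArg I.norm (Subtype.ext (by
    change (y : H →L[ℂ] H) * (a * b) = 1 * ((y : H →L[ℂ] H) * a) * b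
    rw [one_mul, mul_assoc]))

theorem leftSeminorm_le (I : SNIdeal H) (y : I.carrier) (a : H →L[ℂ] H) :
    I.leftSeminorm y a ≤ ‖a‖ * I.norm y := by
  have h := I.leftSeminorm_mul_le y a 1
  have e : I.leftSeminorm y 1 = I.norm y := congrArg I.norm (Subtype.ext (one_mul _))
  rwa [mul_one, e] at h

theorem rightSeminorm_le (I : SNIdeal H) (y : I.carrier) (a : H →L[ℂ] H) :
    I.rightSeminorm y a ≤ ‖a‖ * I.norm y := by
  have h := I.rightSeminorm_mul_le y 1 a
  have e : I.rightSeminorm y 1 = I.norm y := congrArg I.norm (Subtype.ext (mul_one _))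
  rwa [one_mul, e, mul_comm] at h

theorem leftSeminorm_congr (I : SNIdeal H) {y z : I.carrier} {a : H →L[ℂ] H}
    (h : a * (y : H →L[ℂ] H) = a * (z : H →L[ℂ] H)) :
    I.leftSeminorm y a = I.leftSeminorm z a :=
  congrArg I.norm (Subtype.ext h)

theorem rightSeminorm_congr (I : SNIdeal H) {y z : I.carrier} {a : H →L[ℂ] H}
    (h : (y : H →L[ℂ] H) * a = (z : H →L[ℂ] H) * a) :
    I.rightSeminorm y a = I.rightSeminorm z a :=
  congrArg I.norm (Subtype.ext h)

/-- In an approximable sn-ideal, the seminorms attached to `y` are dominated by those attached to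
a compact operator. -/
theorem IsApproximable.exists_compact_seminorm_le {I : SNIdeal H} (hI : I.IsApproximable)
    (y : I.carrier) :
    ∃ k : H →L[ℂ] H, IsCompactOperator k ∧ ∃ C : ℝ, ∀ x,
      I.leftSeminorm y x ≤ C * ‖x * k‖ ∧ I.rightSeminorm y x ≤ C * ‖k * x‖ := by
  have hy : y ∈ I.approximablePart := hI ▸ Set.mem_univ y
  choose F hF hyF using fun n : ℕ => hy ((1 / 4) ^ (n + 1)) (by positivity)
  -- The range serves the left seminorm and `(ker F)ᗮ` the right one.
  let U : ℕ → Submodule ℂ H := fun n =>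
    LinearMap.range ((F n : H →L[ℂ] H) : H →ₗ[ℂ] H) ⊔
      (LinearMap.ker ((F n : H →L[ℂ] H) : H →ₗ[ℂ] H))ᗮ
  have hU : ∀ n, FiniteDimensional ℂ (U n) := fun n =>
    have := hF n
    have := finiteDimensional_orthogonal_ker (F n : H →L[ℂ] H) (hF n)
    Submodule.finiteDimensional_sup _ _
  -- `W 0 = ⊥` starts the chain at `0`; `W (n + 1)` contains `U n`, matching the tolerance
  -- `4⁻⁽ⁿ⁺¹⁾`.
  let W : ℕ → Submodule ℂ H := fun n => (Finset.range n).sup U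
  have hW : ∀ n, FiniteDimensional ℂ (W n) := fun n => Submodule.finiteDimensional_finset_sup _ _
  have hmono : Monotone W := fun m n h => Finset.sup_mono (Finset.range_mono h)
  have hUW : ∀ n, U n ≤ W (n + 1) := fun n =>
    Finset.le_sup (f := U) (Finset.self_mem_range_succ n)
  have hnorm : ∀ n, ‖1 - (W n).starProjection‖ ≤ 1 := fun n => by
    have h := Submodule.starProjection_norm_le (W n)ᗮ
    rwa [Submodule.starProjection_orthogonal'] at h
  have hp0 : (W 0).starProjection = 0 := by simp [W]
  have hl : ∀ m n, m ≤ n →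
      (W m).starProjection * (W n).starProjection = (W m).starProjection := fun m n h =>
    Submodule.starProjection_comp_starProjection_of_le (hmono h)
  have hr : ∀ m n, m ≤ n →
      (W n).starProjection * (W m).starProjection = (W m).starProjection := fun m n h =>
    starProjection_mul_of_range_le _ _
      ((Submodule.range_starProjection (W m)).le.trans (hmono h))
  -- In the constant, `I.norm y` covers `n = 0` and `1` covers the rest, where `1 - p (n + 1)` kills
  -- `F n` and `y` may be replaced by `y - F n`.
  have hleft : ∀ n,
      I.leftSeminorm y (1 - (W n).starProjection) ≤ (I.norm y + 1) * (1 / 4) ^ n := by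
    intro n
    cases n with
    | zero =>
      have := I.leftSeminorm_le y (1 - (W 0).starProjection)
      have := mul_le_of_le_one_left (apply_nonneg I.norm y) (hnorm 0)
      simp only [pow_zero]
      linarith
    | succ n =>
      have hFW := starProjection_mul_of_range_le (F n : H →L[ℂ] H) (W (n + 1))
        (le_sup_left.trans (hUW n))
      rw [I.leftSeminorm_congr (z := y - F n) (by
        simp only [Submodule.coe_sub, mul_sub, sub_mul, one_mul, hFW]; abel)]
      refine (I.leftSeminorm_le _ _).trans
        ((mul_le_of_le_one_left (apply_nonneg I.norm _) (hnorm _)).trans ((hyF n).le.trans ?_))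
      exact le_mul_of_one_le_left (by positivity) (by linarith [apply_nonneg I.norm y])
  have hright : ∀ n,
      I.rightSeminorm y (1 - (W n).starProjection) ≤ (I.norm y + 1) * (1 / 4) ^ n := by
    intro n
    cases n with
    | zero =>
      have := I.rightSeminorm_le y (1 - (W 0).starProjection)
      have := mul_le_of_le_one_left (apply_nonneg I.norm y) (hnorm 0)
      simp only [pow_zero]
      linarith
    | succ n =>
      have hFW := mul_starProjection_of_orthogonal_ker_le (F n : H →L[ℂ] H) (W (n + 1))
        (le_sup_right.trans (hUW n))
      rw [I.rightSeminorm_congr (z := y - F n) (by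
        simp only [Submodule.coe_sub, mul_sub, sub_mul, mul_one, hFW]; abel)]
      refine (I.rightSeminorm_le _ _).trans
        ((mul_le_of_le_one_left (apply_nonneg I.norm _) (hnorm _)).trans ((hyF n).le.trans ?_))
      exact le_mul_of_one_le_left (by positivity) (by linarith [apply_nonneg I.norm y])
  obtain ⟨k, hk, h⟩ := _root_.exists_compact_seminorm_le (I.leftSeminorm y) (I.rightSeminorm y)
    (I.leftSeminorm_mul_le y) (I.rightSeminorm_mul_le y) (fun n => (W n).starProjection) hp0
    (fun n => Submodule.starProjection_norm_le _) (fun n => isCompactOperator_starProjection _)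
    hl hr (I.norm y + 1) hleft hright
  exact ⟨k, hk, _, h⟩

end SNIdeal

theorem mainTheorem8 {H : Type*} [NormedAddCommGroup H] [InnerProductSpace ℂ H]
    [CompleteSpace H] (I : SNIdeal H)
    (hIK : ∀ X ∈ I.carrier, IsCompactOperator X)
    (hI : I.IsApproximable) :
    IsCoarser I.multiplierTopology (SNIdeal.compacts H).multiplierTopology ∧
    IsCoarser I.multiplierStarTopology (SNIdeal.compacts H).multiplierStarTopology ∧
    IsCoarser I.multiplierTopology (strictTopology H) ∧
    IsCoarser I.multiplierStarTopology (strictTopology H) := by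
  refine ⟨isCoarser_of_forall_exists_le _ _ fun y => ?_,
    isCoarser_of_forall_exists_le _ _ fun y => ?_,
    isCoarser_of_forall_exists_le _ _ fun y => ?_,
    isCoarser_of_forall_exists_le _ _ fun y => ?_⟩
  · obtain ⟨k, hk, C, h⟩ := hI.exists_compact_seminorm_le y
    exact ⟨⟨k, hk⟩, C, fun x => (h x).1⟩
  · rcases y with y | y <;> obtain ⟨k, hk, C, h⟩ := hI.exists_compact_seminorm_le y
    · exact ⟨Sum.inl ⟨k, hk⟩, C, fun x => (h x).1⟩
    · exact ⟨Sum.inr ⟨k, hk⟩, C, fun x => (h x).2⟩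
  · obtain ⟨k, hk, C, h⟩ := hI.exists_compact_seminorm_le y
    exact ⟨Sum.inl ⟨k, hk⟩, C, fun x => (h x).1⟩
  · rcases y with y | y <;> obtain ⟨k, hk, C, h⟩ := hI.exists_compact_seminorm_le y
    · exact ⟨Sum.inl ⟨k, hk⟩, C, fun x => (h x).1⟩
    · exact ⟨Sum.inr ⟨k, hk⟩, C, fun x => (h x).2⟩
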